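/- **Setting.** Fix an integer $n\ge 1$. For each $l=1,2,\dots$ let $p^{(l)}:\{0,\dots,n\}\to[0,1]$ satisfy $p^{(l)}(0)=0$, $p^{(l)}(n)=1$ and $0<p^{(l)}(k)<1$ for $0<k<n$, and let $P^{(l)}$ be the transition matrix of the birth and death chain on $\{0,\dots,n\}$ which steps from $k$ to $k-1$ with probability $p^{(l)}(k)$ and to $k+1$ with probability $1-p^{(l)}(k)$. Let $\pi^{(l)}$ be its stationary distribution satisfying detailed balance, $D^{(l)}=\mathrm{diag}(\pi^{(l)}(0),\dots,\pi^{(l)}(n))$, and let $J^{(l)}=(D^{(l)})^{1/2}P^{(l)}(D^{(l)})^{-1/2}$. Let $j^{(l)}\in\{0,\dots,n\}$ be starting points. The one-dimensional continuous-time quantum walk in coordinate $l$ has, at time $t$, the law $$\mathbb P^{(l)}_t(k)=\bigl|\langle k|e^{itJ^{(l)}}|j^{(l)}\rangle\bigr|^2,\qquad k\in\{0,\dots,n\}.$$ For $d\ge1$ put $N=dn$, $N^{(l)}=N/d=n$, $q^{(l)}=1/d$ and $$J_N=\sum_{l=1}^d \tfrac1d\; I\otimes\cdots\otimes \underset{l\text{-th}}{J^{(l)}}\otimes\cdots\otimes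 I .$$ The $d$-dimensional continuous-time quantum walk started at $\mathbf j=(j^{(1)},\dots,j^{(d)})$ is at $\mathbf k\in\{0,\dots,n\}^d$ at time $t$ with probability $|\langle \mathbf k|e^{itJ_N}|\mathbf j\rangle|^2$. **Theorem 2.** Fix $T\ge 0$. Suppose that the laws $\mathbb P^{(l)}_T$, $l\ge1$, are all equal (for instance, because all $p^{(l)}$ are equal and all $j^{(l)}$ are equal), and that their common variance is non-zero. For each $d\ge 1$ let $(Y^{(1)}(T),\dots,Y^{(d)}(T))$ be the position of the $d$-dimensional walk in the time scale in which every coordinate runs for time $T$, i.e. let its joint law be that of the $d$-dimensional walk at time $dT$. Then $Y^{(1)}(T),\dots,Y^{(d)}(T)$ are independent, $Y^{(l)}(T)$ has law $\mathbb P^{(l)}_T$, and with $$Z^{(d)}(T)=\frac1d\sum_{l=1}^d Y^{(l)}(T)$$ we have $$\frac{Z^{(d)}(T)-\mathbb E\,Y^{(1)}(T)}{\sqrt{\operatorname{Var}(Y^{(1)}(T))/d}}\;\Rightarrow\; N(0,1)\qquad (d\to\infty),$$ where $\Rightarrow$ denotes weak convergence and $\mathbb E\,Y^{(1)}(T)$,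 $\operatorname{Var}(Y^{(1)}(T))$ are the mean and variance of $\mathbb P^{(1)}_T$. -/

import Mathlib

open MeasureTheory ProbabilityTheory Filter Topology
open scoped ENNReal

noncomputable section

/-- One-step transition matrix of the birth and death chain on `{0, …, N}` whose probability of
stepping down from `k` is `p k` (and of stepping up is `1 - p k`). Rows are the starting points. -/
def bdMatrix {N : ℕ} (p : Fin (N + 1) → ℝ) : Matrix (Fin (N + 1)) (Fin (N + 1)) ℝ :=
  Matrix.of fun k l =>
    if (l : ℕ) = (k : ℕ) + 1 then 1 - p k
    else if (l : ℕ) + 1 = (k : ℕ) then p k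
    else 0

/-- Admissible step-down probabilities: reflection at both ends, and both directions possible
at every interior point. -/
structure IsBirthDeath {N : ℕ} (p : Fin (N + 1) → ℝ) : Prop where
  zero : p 0 = 0
  last : p (Fin.last N) = 1
  pos : ∀ k, 0 < k → k < Fin.last N → 0 < p k
  lt_one : ∀ k, 0 < k → k < Fin.last N → p k < 1

/-- `π` is a stationary probability distribution of the transition matrix `P` which satisfies the
detailed balance condition. -/
structure IsReversibleDistribution {κ : Type*} [Fintype κ] (P : Matrix κ κ ℝ) (π : κ → ℝ) :
    Prop where
  nonneg : ∀ k, 0 ≤ π k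
  sum_eq_one : ∑ k, π k = 1
  stationary : Matrix.vecMul π P = π
  detailed_balance : ∀ k l, π k * P k l = π l * P l k

/-- The Jacobi matrix `D^{1/2} P D^{-1/2}` with `D = diag π`. -/
def jacobi {κ : Type*} [Fintype κ] [DecidableEq κ] (P : Matrix κ κ ℝ) (π : κ → ℝ) :
    Matrix κ κ ℝ :=
  Matrix.diagonal (fun k => √(π k)) * P * Matrix.diagonal (fun k => (√(π k))⁻¹)

/-- The tensor product `⨂ m, A m` of square matrices, in the basis of elementary tensors
`⨂ m, |x m⟩`, which is indexed by the families `x`. -/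
def tensorMatrix {ι : Type*} [Fintype ι] {κ : ι → Type*} (A : ∀ m, Matrix (κ m) (κ m) ℝ) :
    Matrix (∀ m, κ m) (∀ m, κ m) ℝ :=
  Matrix.of fun x y => ∏ m, A m (x m) (y m)

/-- The multi-dimensional matrix `∑ l, q l • (I ⊗ ⋯ ⊗ A l ⊗ ⋯ ⊗ I)`, where `q l` is the
probability that the coordinate `l` is selected. -/
def multiMatrix {ι : Type*} [Fintype ι] [DecidableEq ι] {κ : ι → Type*} [∀ m, DecidableEq (κ m)]
    (q : ι → ℝ) (A : ∀ m, Matrix (κ m) (κ m) ℝ) : Matrix (∀ m, κ m) (∀ m, κ m) ℝ :=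
  ∑ l, q l • tensorMatrix (Function.update (fun m => (1 : Matrix (κ m) (κ m) ℝ)) l (A l))

/-- The time evolution operator `exp (i t H)`. -/
def evolution {κ : Type*} [Fintype κ] [DecidableEq κ] (H : Matrix κ κ ℝ) (t : ℝ) :
    Matrix κ κ ℂ :=
  NormedSpace.exp ((Complex.I * (t : ℂ)) • H.map (fun a : ℝ => (a : ℂ)))

/-- The transition probability `|⟨k| exp (i t H) |j⟩|²`. -/
def transitionProb {κ : Type*} [Fintype κ] [DecidableEq κ] (H : Matrix κ κ ℝ) (t : ℝ)
    (j k : κ) : ℝ :=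
  ‖evolution H t k j‖ ^ 2

/-- The law at time `t` of the position of the continuous time quantum walk generated by `H`
and started at `j`. -/
def ctqwLaw {κ : Type*} [Fintype κ] [DecidableEq κ] [MeasurableSpace κ] (H : Matrix κ κ ℝ)
    (t : ℝ) (j : κ) : Measure κ :=
  ∑ k, ENNReal.ofReal (transitionProb H t j k) • Measure.dirac k

end

/-! The summands of the generator act on different tensor factors, so they commute and the
exponential of their sum is the tensor product of the exponentials
(`Matrix.exp_sum_piTensorSingle`). Squared amplitudes therefore multiply, and the joint law is the
product of the one-dimensional laws (`ctqwLaw_multiMatrix`); weight 1/d cancels time dT. Detailed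
balance makes each Jacobi matrix symmetric, so the evolution is unitary and the factors are
probability measures. What remains is the classical central limit theorem, applied to rows of i.i.d.
variables. -/

section Tensor

variable {ι : Type*} [Fintype ι] {κ : ι → Type*} {R : Type*} [CommRing R]

/-- The tensor product `⨂ m, A m` of square matrices over a commutative ring. -/
def Matrix.piTensor (A : ∀ m, Matrix (κ m) (κ m) R) : Matrix (∀ m, κ m) (∀ m, κ m) R :=
  Matrix.of fun x y => ∏ m, A m (x m) (y m)

theorem Matrix.piTensor_apply (A : ∀ m, Matrix (κ m) (κ m) R) (x y : ∀ m, κ m) :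
    Matrix.piTensor A x y = ∏ m, A m (x m) (y m) := rfl

theorem map_tensorMatrix (A : ∀ m, Matrix (κ m) (κ m) ℝ) :
    (tensorMatrix A).map (fun a : ℝ => (a : ℂ)) =
      Matrix.piTensor fun m => (A m).map (fun a : ℝ => (a : ℂ)) := by
  ext x y
  simp [tensorMatrix, Matrix.piTensor]

theorem Matrix.piTensor_one [∀ m, DecidableEq (κ m)] :
    Matrix.piTensor (fun m => (1 : Matrix (κ m) (κ m) R)) =
      (1 : Matrix (∀ m, κ m) (∀ m, κ m) R) := by
  ext x y
  by_cases h : x = y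
  · subst h; simp [Matrix.piTensor_apply]
  · obtain ⟨m, hm⟩ := Function.ne_iff.1 h
    rw [Matrix.piTensor_apply, Matrix.one_apply_ne h]
    exact Finset.prod_eq_zero (Finset.mem_univ m) (Matrix.one_apply_ne hm)

variable [∀ m, Fintype (κ m)]

theorem Matrix.piTensor_mul [DecidableEq ι] (A B : ∀ m, Matrix (κ m) (κ m) R) :
    Matrix.piTensor A * Matrix.piTensor B = Matrix.piTensor fun m => A m * B m := by
  ext x y
  simp only [Matrix.mul_apply, Matrix.piTensor_apply, ← Finset.prod_mul_distrib]
  rw [Fintype.prod_sum]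

variable [DecidableEq ι] [∀ m, DecidableEq (κ m)]

/-- The embedding `A ↦ I ⊗ ⋯ ⊗ A ⊗ ⋯ ⊗ I` with `A` in the tensor factor `l`. -/
def Matrix.piTensorSingle (R : Type*) [CommRing R] (l : ι) :
    Matrix (κ l) (κ l) R →+* Matrix (∀ m, κ m) (∀ m, κ m) R where
  toFun A := Matrix.piTensor (Function.update (fun m => (1 : Matrix (κ m) (κ m) R)) l A)
  map_one' := by
    rw [← Matrix.piTensor_one, Function.update_eq_self_iff.2 rfl]
  map_mul' A B := by
    rw [Matrix.piTensor_mul]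
    congr 1
    ext1 m
    obtain rfl | h := eq_or_ne m l
    · simp
    · simp [h]
  map_zero' := by
    ext x y
    exact Finset.prod_eq_zero (Finset.mem_univ l) (by simp)
  map_add' A B := by
    ext x y
    simp only [Matrix.add_apply, Matrix.piTensor_apply,
      ← Finset.mul_prod_erase _ _ (Finset.mem_univ l),
      Function.update_self, add_mul]
    congr 2 <;> refine Finset.prod_congr rfl fun m hm => ?_ <;>
      simp [Finset.ne_of_mem_erase hm]

theorem Matrix.piTensorSingle_apply (l : ι) (A : Matrix (κ l) (κ l) R) :
    Matrix.piTensorSingle R l A =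
      Matrix.piTensor (Function.update (fun m => (1 : Matrix (κ m) (κ m) R)) l A) := rfl

theorem Matrix.piTensorSingle_smul (l : ι) (c : R) (A : Matrix (κ l) (κ l) R) :
    Matrix.piTensorSingle R l (c • A) = c • Matrix.piTensorSingle R l A := by
  ext x y
  simp only [Matrix.smul_apply, Matrix.piTensorSingle_apply, Matrix.piTensor_apply,
    ← Finset.mul_prod_erase _ _ (Finset.mem_univ l), Function.update_self, smul_eq_mul, mul_assoc]
  congr 2
  refine Finset.prod_congr rfl fun m hm => ?_
  simp [Finset.ne_of_mem_erase hm]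

theorem Matrix.commute_piTensorSingle {l l' : ι} (h : l ≠ l') (A : Matrix (κ l) (κ l) R)
    (B : Matrix (κ l') (κ l') R) :
    Commute (Matrix.piTensorSingle R l A) (Matrix.piTensorSingle R l' B) := by
  rw [commute_iff_eq, Matrix.piTensorSingle_apply, Matrix.piTensorSingle_apply,
    Matrix.piTensor_mul, Matrix.piTensor_mul]
  congr 1
  ext1 m
  obtain rfl | hl := eq_or_ne m l
  · simp [h]
  · simp [hl]

/-- A continuous ring homomorphism commutes with the exponential series. -/
theorem Matrix.exp_piTensorSingle (l : ι) (A : Matrix (κ l) (κ l) ℂ) :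
    NormedSpace.exp (Matrix.piTensorSingle ℂ l A) =
      Matrix.piTensorSingle ℂ l (NormedSpace.exp A) := by
  have hc : Continuous (Matrix.piTensorSingle ℂ l :
      Matrix (κ l) (κ l) ℂ →+* Matrix (∀ m, κ m) (∀ m, κ m) ℂ) := by
    refine continuous_matrix fun x y => ?_
    simp only [Matrix.piTensorSingle_apply, Matrix.piTensor_apply,
      ← Finset.mul_prod_erase _ _ (Finset.mem_univ l), Function.update_self]
    refine (Continuous.matrix_elem continuous_id _ _).mul ?_
    -- Only the factor at `l` depends on `A`.
    have : ∀ A : Matrix (κ l) (κ l) ℂ, (∏ m ∈ Finset.univ.erase l,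
        Function.update (fun m => (1 : Matrix (κ m) (κ m) ℂ)) l A m (x m) (y m)) =
        ∏ m ∈ Finset.univ.erase l, (1 : Matrix (κ m) (κ m) ℂ) (x m) (y m) := fun A =>
      Finset.prod_congr rfl fun m hm => by simp [Finset.ne_of_mem_erase hm]
    simp only [this]
    exact continuous_const
  open scoped Matrix.Norms.Operator in exact (NormedSpace.map_exp _ hc A).symm

theorem Matrix.exp_sum_piTensorSingle (A : ∀ m, Matrix (κ m) (κ m) ℂ) :
    NormedSpace.exp (∑ l, Matrix.piTensorSingle ℂ l (A l)) =
      Matrix.piTensor fun m => NormedSpace.exp (A m) := by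
  -- For the induction, slots outside `s` carry the identity.
  have key : ∀ s : Finset ι, NormedSpace.exp (∑ l ∈ s, Matrix.piTensorSingle ℂ l (A l)) =
      Matrix.piTensor fun m => if m ∈ s then NormedSpace.exp (A m) else 1 := by
    intro s
    induction s using Finset.induction_on with
    | empty => simp [Matrix.piTensor_one]
    | insert l s hl ih =>
      rw [Finset.sum_insert hl, Matrix.exp_add_of_commute, ih, Matrix.exp_piTensorSingle,
        Matrix.piTensorSingle_apply, Matrix.piTensor_mul]
      · congr 1
        ext1 m
        obtain rfl | h := eq_or_ne m l
        · simp [hl]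
        · simp [h]
      · exact Commute.sum_right _ _ _ fun m hm =>
          Matrix.commute_piTensorSingle (ne_of_mem_of_not_mem hm hl).symm _ _
  simpa using key Finset.univ

theorem evolution_multiMatrix (q : ι → ℝ) (A : ∀ m, Matrix (κ m) (κ m) ℝ) (t : ℝ)
    (x y : ∀ m, κ m) :
    evolution (multiMatrix q A) t x y = ∏ m, evolution (A m) (q m * t) (x m) (y m) := by
  rw [← Matrix.piTensor_apply (fun m => evolution (A m) (q m * t))]
  unfold evolution
  rw [← Matrix.exp_sum_piTensorSingle]
  have h : (multiMatrix q A).map (fun a : ℝ => (a : ℂ)) =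
      ∑ l, (q l : ℂ) • Matrix.piTensorSingle ℂ l ((A l).map (fun a : ℝ => (a : ℂ))) := by
    have h1 : ∀ l, Matrix.piTensorSingle ℂ l ((A l).map (fun a : ℝ => (a : ℂ))) =
        (tensorMatrix (Function.update (fun m => (1 : Matrix (κ m) (κ m) ℝ)) l (A l))).map
          (fun a : ℝ => (a : ℂ)) := fun l => by
      rw [map_tensorMatrix, Matrix.piTensorSingle_apply]
      congr 1
      ext1 m
      obtain rfl | h := eq_or_ne m l
      · simp
      · simp [h]
    ext x y
    simp [multiMatrix, Matrix.sum_apply, h1]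
  rw [h, Finset.smul_sum]
  refine congrArg (fun M : Matrix (∀ m, κ m) (∀ m, κ m) ℂ => NormedSpace.exp M x y)
     (Finset.sum_congr rfl fun l _ => ?_)
  rw [Matrix.piTensorSingle_smul, smul_smul]
  push_cast
  congr 1
  ring

theorem transitionProb_multiMatrix (q : ι → ℝ) (A : ∀ m, Matrix (κ m) (κ m) ℝ) (t : ℝ)
    (x y : ∀ m, κ m) :
    transitionProb (multiMatrix q A) t x y =
      ∏ m, transitionProb (A m) (q m * t) (x m) (y m) := by
  simp only [transitionProb, evolution_multiMatrix, norm_prod, Finset.prod_pow]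

end Tensor

/-! ### Unitarity and the law of the walk. -/

section Law

variable {κ : Type*} [Fintype κ] [DecidableEq κ]

theorem transitionProb_nonneg (H : Matrix κ κ ℝ) (t : ℝ) (j k : κ) :
    0 ≤ transitionProb H t j k := by
  unfold transitionProb; positivity

/-- For real symmetric `H` the exponent is skew-Hermitian. -/
theorem conjTranspose_evolution_mul_evolution {H : Matrix κ κ ℝ} (hH : H.IsSymm) (t : ℝ) :
    (evolution H t).conjTranspose * evolution H t = 1 := by
  have hs : ((Complex.I * (t : ℂ)) • H.map (fun a : ℝ => (a : ℂ))).conjTranspose =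
      -((Complex.I * (t : ℂ)) • H.map (fun a : ℝ => (a : ℂ))) := by
    ext a b
    simp [hH.apply]
  rw [evolution, ← Matrix.exp_conjTranspose, hs,
    ← Matrix.exp_add_of_commute, neg_add_cancel, NormedSpace.exp_zero]
  exact (Commute.refl ((Complex.I * (t : ℂ)) • H.map (fun a : ℝ => (a : ℂ)))).neg_left

theorem sum_transitionProb {H : Matrix κ κ ℝ} (hH : H.IsSymm) (t : ℝ) (j : κ) :
    ∑ k, transitionProb H t j k = 1 := by
  have h := congrFun (congrFun (conjTranspose_evolution_mul_evolution hH t) j) j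
  rw [Matrix.mul_apply, Matrix.one_apply_eq] at h
  have h2 : ((∑ k, transitionProb H t j k : ℝ) : ℂ) = 1 := by
    rw [← h]
    push_cast [transitionProb]
    refine Finset.sum_congr rfl fun k _ => ?_
    rw [Matrix.conjTranspose_apply, ← Complex.conj_mul']
    rfl
  exact_mod_cast h2

variable [MeasurableSpace κ]

theorem isProbabilityMeasure_ctqwLaw {H : Matrix κ κ ℝ} (hH : H.IsSymm) (t : ℝ) (j : κ) :
    IsProbabilityMeasure (ctqwLaw H t j) where
  measure_univ := by
    simp [ctqwLaw, ← ENNReal.ofReal_sum_of_nonneg fun k _ => transitionProb_nonneg H t j k,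
      sum_transitionProb hH]

theorem ctqwLaw_singleton [MeasurableSingletonClass κ] (H : Matrix κ κ ℝ) (t : ℝ) (j k : κ) :
    ctqwLaw H t j {k} = ENNReal.ofReal (transitionProb H t j k) := by
  simp [ctqwLaw, Set.indicator_apply, eq_comm]

theorem ctqwLaw_multiMatrix {ι : Type*} [Fintype ι] [DecidableEq ι] {κ : ι → Type*}
    [∀ m, Fintype (κ m)] [∀ m, DecidableEq (κ m)] [∀ m, MeasurableSpace (κ m)]
    [∀ m, MeasurableSingletonClass (κ m)] (q : ι → ℝ) (A : ∀ m, Matrix (κ m) (κ m) ℝ)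
    (hA : ∀ m, (A m).IsSymm) (t : ℝ) (j : ∀ m, κ m) :
    ctqwLaw (multiMatrix q A) t j = Measure.pi fun m => ctqwLaw (A m) (q m * t) (j m) := by
  have := fun m => isProbabilityMeasure_ctqwLaw (hA m) (q m * t) (j m)
  refine Measure.ext_of_singleton fun k => ?_
  rw [Measure.pi_singleton, ctqwLaw_singleton, transitionProb_multiMatrix,
    ENNReal.ofReal_prod_of_nonneg fun m _ => transitionProb_nonneg _ _ _ _]
  simp only [ctqwLaw_singleton]

end Law

/-- Clearing the square roots turns symmetry into detailed balance. Where `π` vanishes, both entries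
are zero because `0⁻¹ = 0`. -/
theorem IsReversibleDistribution.isSymm_jacobi {κ : Type*} [Fintype κ] [DecidableEq κ]
    {P : Matrix κ κ ℝ} {π : κ → ℝ} (h : IsReversibleDistribution P π) :
    (jacobi P π).IsSymm := by
  have hentry : ∀ k l, jacobi P π k l = √(π k) * P k l * (√(π l))⁻¹ := fun k l => by
    simp [jacobi, Matrix.mul_diagonal, Matrix.diagonal_mul]
  refine Matrix.IsSymm.ext fun k l => ?_
  rw [hentry, hentry]
  rcases (h.nonneg k).eq_or_lt with hk | hk
  · simp [← hk]
  rcases (h.nonneg l).eq_or_lt with hl | hl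
  · simp [← hl]
  have hk' := Real.sqrt_pos.2 hk
  have hl' := Real.sqrt_pos.2 hl
  have hb := h.detailed_balance k l
  field_simp
  rw [Real.sq_sqrt hk.le, Real.sq_sqrt hl.le]
  linarith

/-- **Central limit theorem** for the empirical means of the rows of a triangular array, each row
of which consists of independent random variables with law `ν`. -/
theorem tendstoInDistribution_mean_of_hasLaw_pi {S : Type*} [MeasurableSpace S] (ν : Measure S)
    [IsProbabilityMeasure ν] {f : S → ℝ} (hf : Measurable f) (hv : Var[f; ν] ≠ 0)
    {Ω : ℕ → Type*} [∀ d, MeasurableSpace (Ω d)] (μ : ∀ d, Measure (Ω d))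
    [∀ d, IsProbabilityMeasure (μ d)] (Y : ∀ d, Fin d → Ω d → S)
    (hY : ∀ d, 0 < d → HasLaw (fun ω (l : Fin d) => Y d l ω) (Measure.pi fun _ => ν) (μ d)) :
    TendstoInDistribution
      (fun (d : ℕ) (ω : Ω d) =>
        ((1 / (d : ℝ)) * ∑ l : Fin d, f (Y d l ω) - ∫ k, f k ∂ν) / √(Var[f; ν] / d))
      atTop (id : ℝ → ℝ) μ (gaussianReal 0 1) := by
  have hY' : ∀ d, HasLaw (fun ω (l : Fin d) => Y d l ω) (Measure.pi fun _ => ν) (μ d) := by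
    -- Row 0 needs no hypothesis: `Fin 0 → S` has a single point.
    rintro (_ | d)
    · refine ⟨(measurable_of_subsingleton_codomain _).aemeasurable, ?_⟩
      rw [Measure.pi_of_empty (x := fun l : Fin 0 => l.elim0),
        show (fun ω (l : Fin 0) => Y 0 l ω) = fun _ l => l.elim0 from Subsingleton.elim _ _,
        Measure.map_const, measure_univ, one_smul]
    · exact hY _ d.succ_pos
  -- Convergence in distribution sees only the law of each row, so the rows may be replaced by
  -- initial segments of one i.i.d. sequence.
  obtain ⟨Ω', _, P, X, hXm, hX, hindep, hP⟩ := exists_iid ℕ ν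
  -- A function outside L² has variance 0 by convention, so `hv` forces square integrability.
  have hint : Integrable f ν := memLp_one_iff_integrable.1 <|
    (memLp_two_of_variance_ne_zero hf.aestronglyMeasurable hv).mono_exponent (by simp)
  have hu : Measurable fun s => (f s - ∫ k, f k ∂ν) / √Var[f; ν] := by fun_prop
  have hclt := tendstoInDistribution_inv_sqrt_mul_sum (P := P) (P' := gaussianReal 0 1)
    (X := fun i ω => (f (X i ω) - ∫ k, f k ∂ν) / √Var[f; ν]) (Y := id) HasLaw.id
    (by
      refine ((hX 0).integral_comp hu.aestronglyMeasurable).trans ?_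
      rw [integral_div, integral_sub hint (by simp)]
      simp)
    (by
      refine ((hX 0).integral_comp (f := fun s => ((f s - ∫ k, f k ∂ν) / √Var[f; ν]) ^ 2)
        (by fun_prop)).trans ?_
      simp only [div_pow]
      rw [integral_div, ← variance_eq_integral hf.aemeasurable,
        Real.sq_sqrt (variance_nonneg _ _), div_self hv])
    (hindep.comp (fun _ s => (f s - ∫ k, f k ∂ν) / √Var[f; ν]) fun _ => hu)
    (fun i => ((hX i).identDistrib (hX 0)).comp hu)
  have hg : ∀ d, Measurable fun x : Fin d → S =>
      ((1 / (d : ℝ)) * ∑ l : Fin d, f (x l) - ∫ k, f k ∂ν) / √(Var[f; ν] / d) := fun d => by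
    fun_prop
  have hXd : ∀ d, HasLaw (fun ω (l : Fin d) => X l ω) (Measure.pi fun _ => ν) P := fun d =>
    (iIndepFun_iff_hasLaw_pi_pi fun l : Fin d => hX l).1 (hindep.precomp Fin.val_injective)
  have hident : ∀ d : ℕ, IdentDistrib
      (fun ω => ((1 / (d : ℝ)) * ∑ l : Fin d, f (Y d l ω) - ∫ k, f k ∂ν) / √(Var[f; ν] / d))
      (fun ω => (√d)⁻¹ * ∑ k ∈ Finset.range d, (f (X k ω) - ∫ k, f k ∂ν) / √Var[f; ν])
      (μ d) P := fun d => by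
    convert! ((hY' d).identDistrib (hXd d)).comp (hg d) using 1
    funext ω
    rw [Function.comp_apply, ← Finset.sum_div, Finset.sum_sub_distrib, Finset.sum_range,
      Real.sqrt_div (variance_nonneg _ _)]
    -- At `d = 0` both sides are 0, the left one through division by zero.
    obtain rfl | hd := Nat.eq_zero_or_pos d
    · simp
    have hd' : (0 : ℝ) < d := by exact_mod_cast hd
    have hs := Real.sqrt_pos.2 hd'
    have hs2 := Real.sq_sqrt hd'.le
    have hV := Real.sqrt_pos.2 ((variance_nonneg f ν).lt_of_ne' hv)
    simp only [Finset.sum_const, Finset.card_range, nsmul_eq_mul]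
    field_simp
    rw [hs2]
  refine ⟨fun d => (hident d).aemeasurable_fst, aemeasurable_id, ?_⟩
  have h := hclt.tendsto
  refine h.congr fun d => Subtype.ext ?_
  exact (hident d).map_eq.symm
theorem theorem2
    -- each coordinate lives on `{0, …, n}`: `N = d * n` in dimension `d`
    (n : ℕ) (hn : 1 ≤ n)
    -- coordinate `l` has step-down probabilities `p l`, reversible distribution `π l`, start `j l`
    (p : ℕ → Fin (n + 1) → ℝ) (hp : ∀ l, IsBirthDeath (p l))
    (π : ℕ → Fin (n + 1) → ℝ) (hπ : ∀ l, IsReversibleDistribution (bdMatrix (p l)) (π l))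
    (j : ℕ → Fin (n + 1))
    (T : ℝ) (hT : 0 ≤ T)
    -- the one-dimensional walks have the same law at time `T`, and it is not a point mass
    (hid : ∀ l, ctqwLaw (jacobi (bdMatrix (p l)) (π l)) T (j l) =
      ctqwLaw (jacobi (bdMatrix (p 0)) (π 0)) T (j 0))
    (hvar : Var[fun k : Fin (n + 1) => ((k : ℕ) : ℝ);
      ctqwLaw (jacobi (bdMatrix (p 0)) (π 0)) T (j 0)] ≠ 0)
    {Ω : ℕ → Type*} [∀ d, MeasurableSpace (Ω d)] (μ : ∀ d, Measure (Ω d))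
    [∀ d, IsProbabilityMeasure (μ d)]
    (Y : ∀ d, Fin d → Ω d → Fin (n + 1))
    -- `Y d` is the position of the `d`-dimensional walk with `q = 1 / d`, in the time scale in
    -- which each coordinate runs for time `T`, that is, at time `d * T` of the joint evolution
    (hY : ∀ d, 0 < d → HasLaw (fun ω (l : Fin d) => Y d l ω)
      (ctqwLaw
        (multiMatrix (fun _ : Fin d => 1 / (d : ℝ))
          (fun l : Fin d => jacobi (bdMatrix (p l)) (π l)))
        (d * T) (fun l : Fin d => j l))
      (μ d)) :
    (∀ d, 0 < d → iIndepFun (Y d) (μ d) ∧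
      ∀ l : Fin d, HasLaw (Y d l) (ctqwLaw (jacobi (bdMatrix (p l)) (π l)) T (j l)) (μ d)) ∧
    TendstoInDistribution
      (fun (d : ℕ) (ω : Ω d) =>
        ((1 / (d : ℝ)) * ∑ l : Fin d, ((Y d l ω : ℕ) : ℝ) -
            ∫ k, ((k : ℕ) : ℝ) ∂(ctqwLaw (jacobi (bdMatrix (p 0)) (π 0)) T (j 0))) /
          √(Var[fun k : Fin (n + 1) => ((k : ℕ) : ℝ);
              ctqwLaw (jacobi (bdMatrix (p 0)) (π 0)) T (j 0)] / d))
      atTop (id : ℝ → ℝ) μ (gaussianReal 0 1) := by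
  have hsymm := fun l => (hπ l).isSymm_jacobi
  have hprob := fun l => isProbabilityMeasure_ctqwLaw (hsymm l) T (j l)
  have hpi : ∀ d, 0 < d → HasLaw (fun ω (l : Fin d) => Y d l ω)
      (Measure.pi fun l : Fin d => ctqwLaw (jacobi (bdMatrix (p l)) (π l)) T (j l)) (μ d) := by
    intro d hd
    have hd' : (d : ℝ) ≠ 0 := by exact_mod_cast hd.ne'
    have h := hY d hd
    rw [ctqwLaw_multiMatrix _ _ fun l : Fin d => hsymm l] at h
    have ht : 1 / (d : ℝ) * (d * T) = T := by field_simp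
    simpa only [ht] using h
  refine ⟨fun d hd => ?_, ?_⟩
  · have hlaw : ∀ l : Fin d,
        HasLaw (Y d l) (ctqwLaw (jacobi (bdMatrix (p l)) (π l)) T (j l)) (μ d) := fun l =>
      (measurePreserving_eval
        (fun l : Fin d => ctqwLaw (jacobi (bdMatrix (p l)) (π l)) T (j l)) l).hasLaw.comp
        (hpi d hd)
    exact ⟨(iIndepFun_iff_hasLaw_pi_pi hlaw).2 (hpi d hd), hlaw⟩
  · refine tendstoInDistribution_mean_of_hasLaw_pi
      (ctqwLaw (jacobi (bdMatrix (p 0)) (π 0)) T (j 0)) (f := fun k => ((k : ℕ) : ℝ))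
      (measurable_of_finite _) hvar μ Y fun d hd => ?_
    simpa only [hid] using hpi d hd
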